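/- Let $\Bbbk$ be a commutative ring and let $A=\bigoplus_{i\ge 0}A_i$ be a finitely graded (associative, unital) $\Bbbk$-algebra, i.e. a non-negatively graded $\Bbbk$-algebra with $A_i=0$ for $i\gg 0$. Let $\operatorname{Mod}A$ be the category of right $A$-modules, and let $\operatorname{GrMod}A$ be the category of $\mathbb Z$-graded right $A$-modules $M=\bigoplus_{i\in\mathbb Z}M_i$ with degree-preserving $A$-linear maps as morphisms. Write $\operatorname{injdim}M$ for the injective dimension of $M$ in $\operatorname{Mod}A$ and $\operatorname{grinjdim}M$ for its injective dimension in $\operatorname{GrMod}A$, both with values in $\{-\infty\}\cup\mathbb N\cup\{\infty\}$ (the value $-\infty$ being taken exactly by the zero module). Then for every finitely graded right $A$-module $M$, i.e. every $M\in\operatorname{GrMod}A$ with $M_i=0$ for $|i|\gg 0$, $$\operatorname{injdim}M=\operatorname{grinjdim}M .$$ As a consequence, for the graded right module $A_A$, $$\operatorname{injdim}A_A=\operatorname{grinjdim}A_A .$$ -/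

import Mathlib

open CategoryTheory CategoryTheory.Limits

universe w v u

/-- `A = ⨁_{i ≥ 0} A_i` is *finitely graded* if `A_i = 0` for all `i ≫ 0`. -/
def IsFinitelyGradedAlgebra {𝕜 : Type w} [CommRing 𝕜] {A : Type u} [Ring A] [Algebra 𝕜 A]
    (𝒜 : ℕ → Submodule 𝕜 A) : Prop :=
  ∃ l : ℕ, ∀ i : ℕ, l < i → 𝒜 i = ⊥

/-- A graded right module `M = ⨁_{i ∈ ℤ} M_i` over the graded algebra `A = ⨁_{j ≥ 0} A_j`.
Right `A`-modules are modules over `Aᵐᵒᵖ`; the action of `a` on `m` from the right is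
`MulOpposite.op a • m`. -/
structure GrMod {𝕜 : Type w} [CommRing 𝕜] {A : Type u} [Ring A] [Algebra 𝕜 A]
    (𝒜 : ℕ → Submodule 𝕜 A) where
  carrier : Type v
  [isAddCommGroup : AddCommGroup carrier]
  [isModule : Module Aᵐᵒᵖ carrier]
  /-- the homogeneous component of degree `i` -/
  deg : ℤ → AddSubgroup carrier
  isInternal : DirectSum.IsInternal deg
  smul_mem : ∀ {i : ℤ} {j : ℕ} {m : carrier} {a : A},
    m ∈ deg i → a ∈ 𝒜 j → MulOpposite.op a • m ∈ deg (i + j)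

namespace GrMod

attribute [instance] isAddCommGroup isModule

variable {𝕜 : Type w} [CommRing 𝕜] {A : Type u} [Ring A] [Algebra 𝕜 A]
  {𝒜 : ℕ → Submodule 𝕜 A}

/-- A graded module is *finitely graded* if `M_i = 0` for `|i| ≫ 0`. -/
def IsFinitelyGraded (M : GrMod.{w, v, u} 𝒜) : Prop :=
  ∃ n : ℕ, ∀ i : ℤ, (n : ℤ) < |i| → M.deg i = ⊥

/-- Morphisms of graded modules: `A`-linear maps that preserve the degree. -/
@[ext]
structure Hom (M N : GrMod.{w, v, u} 𝒜) where
  hom : M.carrier →ₗ[Aᵐᵒᵖ] N.carrier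
  map_mem : ∀ {i : ℤ} {m : M.carrier}, m ∈ M.deg i → hom m ∈ N.deg i

instance : Category (GrMod.{w, v, u} 𝒜) where
  Hom M N := Hom M N
  id M := ⟨LinearMap.id, fun h => h⟩
  comp f g := ⟨g.hom ∘ₗ f.hom, fun h => g.map_mem (f.map_mem h)⟩

variable {M N K : GrMod.{w, v, u} 𝒜}

@[ext]
theorem hom_ext {f g : M ⟶ N} (h : f.hom = g.hom) : f = g := Hom.ext h

theorem hom_ext_apply {f g : M ⟶ N} (h : ∀ x, f.hom x = g.hom x) : f = g :=
  Hom.ext (LinearMap.ext h)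

@[simp] theorem id_hom : Hom.hom (𝟙 M) = LinearMap.id := rfl

@[simp] theorem comp_hom (f : M ⟶ N) (g : N ⟶ K) : (f ≫ g).hom = g.hom ∘ₗ f.hom := rfl

instance : Zero (M ⟶ N) := ⟨⟨0, fun _ => zero_mem _⟩⟩
instance : Add (M ⟶ N) :=
  ⟨fun f g => ⟨f.hom + g.hom, fun h => add_mem (f.map_mem h) (g.map_mem h)⟩⟩
instance : Neg (M ⟶ N) := ⟨fun f => ⟨-f.hom, fun h => neg_mem (f.map_mem h)⟩⟩

@[simp] theorem zero_hom : Hom.hom (0 : M ⟶ N) = 0 := rfl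
@[simp] theorem add_hom (f g : M ⟶ N) : (f + g).hom = f.hom + g.hom := rfl
@[simp] theorem neg_hom (f : M ⟶ N) : (-f).hom = -f.hom := rfl

instance : AddCommGroup (M ⟶ N) where
  add_assoc f g h := hom_ext (add_assoc _ _ _)
  zero_add f := hom_ext (zero_add _)
  add_zero f := hom_ext (add_zero _)
  neg_add_cancel f := hom_ext (neg_add_cancel _)
  add_comm f g := hom_ext (add_comm _ _)
  nsmul := nsmulRec
  zsmul := zsmulRec

instance : Preadditive (GrMod.{w, v, u} 𝒜) where
  add_comp _ _ _ _ _ h := hom_ext (LinearMap.comp_add _ _ h.hom)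
  comp_add _ _ _ _ _ _ := hom_ext (LinearMap.add_comp _ _ _)

variable (𝒜) in
/-- The functor from graded modules to (ungraded) modules that forgets the grading. -/
def forgetGrading : GrMod.{w, v, u} 𝒜 ⥤ ModuleCat.{v} Aᵐᵒᵖ where
  obj M := ModuleCat.of Aᵐᵒᵖ M.carrier
  map f := ModuleCat.ofHom f.hom

/-! ### Homogeneous components -/

/-- The projection of `M` to its component of degree `i`, as an endomorphism of `M`. -/
noncomputable def comp (M : GrMod.{w, v, u} 𝒜) (i : ℤ) : M.carrier →+ M.carrier :=
  ((M.deg i).subtype.comp (DFinsupp.evalAddMonoidHom i)).comp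
    (AddEquiv.ofBijective (DirectSum.coeAddMonoidHom M.deg) M.isInternal).symm.toAddMonoidHom

theorem comp_coe (M : GrMod.{w, v, u} 𝒜) (i : ℤ) (x : DirectSum ℤ fun i => M.deg i) :
    M.comp i (DirectSum.coeAddMonoidHom M.deg x) = x i := by
  have : (AddEquiv.ofBijective (DirectSum.coeAddMonoidHom M.deg) M.isInternal).symm
      (DirectSum.coeAddMonoidHom M.deg x) = x :=
    (AddEquiv.ofBijective (DirectSum.coeAddMonoidHom M.deg) M.isInternal).symm_apply_apply x
  simp only [comp, AddMonoidHom.comp_apply]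
  erw [this]
  rfl

theorem comp_mem (M : GrMod.{w, v, u} 𝒜) (i : ℤ) (x : M.carrier) : M.comp i x ∈ M.deg i := by
  obtain ⟨y, rfl⟩ := M.isInternal.2 x
  rw [comp_coe]
  exact (y i).2

theorem comp_of_mem {i : ℤ} {x : M.carrier} (hx : x ∈ M.deg i) : M.comp i x = x := by
  have h := M.comp_coe i (DirectSum.of (fun i => M.deg i) i ⟨x, hx⟩)
  rwa [DirectSum.coeAddMonoidHom_of, DirectSum.of_eq_same] at h

theorem comp_of_mem_ne {i j : ℤ} (hij : i ≠ j) {x : M.carrier} (hx : x ∈ M.deg i) :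
    M.comp j x = 0 := by
  have h := M.comp_coe j (DirectSum.of (fun i => M.deg i) i ⟨x, hx⟩)
  rwa [DirectSum.coeAddMonoidHom_of, DirectSum.of_eq_of_ne _ _ _ hij.symm] at h

theorem exists_sum_comp (M : GrMod.{w, v, u} 𝒜) (x : M.carrier) :
    ∃ s : Finset ℤ, ∀ t, s ⊆ t → ∑ i ∈ t, M.comp i x = x := by
  classical
  obtain ⟨y, rfl⟩ := M.isInternal.2 x
  refine ⟨DFinsupp.support y, fun t ht => ?_⟩
  simp only [comp_coe]
  rw [DirectSum.coeAddMonoidHom_eq_dfinsuppSum, DFinsupp.sum]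
  refine (Finset.sum_subset ht fun i _ hi => ?_).symm
  simpa using hi

/-- A family of subgroups with projections onto them is a grading. -/
theorem isInternal_of_projections {G : Type*} [AddCommGroup G] (d : ℤ → AddSubgroup G)
    (c : ℤ → G →+ G) (h₁ : ∀ i x, c i x ∈ d i) (h₂ : ∀ i x, x ∈ d i → c i x = x)
    (h₃ : ∀ i j x, i ≠ j → x ∈ d i → c j x = 0)
    (h₄ : ∀ x, ∃ s : Finset ℤ, ∑ i ∈ s, c i x = x) : DirectSum.IsInternal d := by
  classical
  have key : ∀ (j : ℤ) (y : DirectSum ℤ fun i => d i),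
      c j (DirectSum.coeAddMonoidHom d y) = y j := by
    intro j y
    induction y using DirectSum.induction_on with
    | zero => simp
    | of i x =>
      rw [DirectSum.coeAddMonoidHom_of]
      by_cases hij : i = j
      · subst hij
        rw [DirectSum.of_eq_same]
        exact h₂ _ _ x.2
      · rw [DirectSum.of_eq_of_ne _ _ _ (Ne.symm hij)]
        exact h₃ _ _ _ hij x.2
    | add x y hx hy => simp [hx, hy]
  constructor
  · intro y z hyz
    refine DFinsupp.ext fun j => Subtype.ext ?_
    exact (key j y).symm.trans ((congrArg (c j) hyz).trans (key j z))
  · intro x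
    obtain ⟨s, hs⟩ := h₄ x
    refine ⟨∑ i ∈ s, DirectSum.of (fun i => d i) i ⟨c i x, h₁ i x⟩, ?_⟩
    rw [map_sum]
    simpa only [DirectSum.coeAddMonoidHom_of] using hs

theorem map_comp (f : M ⟶ N) (i : ℤ) (x : M.carrier) : f.hom (M.comp i x) = N.comp i (f.hom x) := by
  obtain ⟨s, hs⟩ := M.exists_sum_comp x
  have hx : x = ∑ j ∈ insert i s, M.comp j x := (hs _ (Finset.subset_insert i s)).symm
  conv_rhs => rw [hx, map_sum, map_sum]
  rw [Finset.sum_eq_single i]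
  · exact (comp_of_mem (f.map_mem (M.comp_mem i x))).symm
  · intro j _ hj
    exact comp_of_mem_ne hj (f.map_mem (M.comp_mem j x))
  · intro h
    exact absurd (Finset.mem_insert_self i s) h

/-! ### Kernels, cokernels, sums -/

/-- A submodule that is stable under taking homogeneous components, as a graded module. -/
noncomputable def ofSubmodule (M : GrMod.{w, v, u} 𝒜) (S : Submodule Aᵐᵒᵖ M.carrier)
    (hS : ∀ i x, x ∈ S → M.comp i x ∈ S) : GrMod.{w, v, u} 𝒜 where
  carrier := S
  deg i := (M.deg i).comap S.subtype.toAddMonoidHom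
  isInternal := by
    refine isInternal_of_projections _
      (fun i => ((M.comp i).comp S.subtype.toAddMonoidHom).codRestrict S.toAddSubgroup
        fun x => hS i x x.2) ?_ ?_ ?_ ?_
    · intro i x
      exact M.comp_mem i x
    · intro i x hx
      exact Subtype.ext (comp_of_mem hx)
    · intro i j x hij hx
      exact Subtype.ext (comp_of_mem_ne hij hx)
    · intro x
      obtain ⟨s, hs⟩ := M.exists_sum_comp x
      refine ⟨s, Subtype.ext ?_⟩
      erw [AddSubmonoidClass.coe_finsetSum]
      exact hs s subset_rfl
  smul_mem hm ha := M.smul_mem hm ha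

/-- The quotient by a submodule that is stable under taking homogeneous components. -/
noncomputable def quotient (M : GrMod.{w, v, u} 𝒜) (S : Submodule Aᵐᵒᵖ M.carrier)
    (hS : ∀ i x, x ∈ S → M.comp i x ∈ S) : GrMod.{w, v, u} 𝒜 where
  carrier := M.carrier ⧸ S
  deg i := (M.deg i).map S.mkQ.toAddMonoidHom
  isInternal := by
    refine isInternal_of_projections _
      (fun i => QuotientAddGroup.map S.toAddSubgroup S.toAddSubgroup (M.comp i)
        fun x hx => hS i x hx) ?_ ?_ ?_ ?_
    · intro i x
      obtain ⟨x, rfl⟩ := S.mkQ_surjective x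
      exact ⟨M.comp i x, M.comp_mem i x, rfl⟩
    · rintro i _ ⟨x, hx, rfl⟩
      exact congrArg S.mkQ (comp_of_mem hx)
    · rintro i j _ hij ⟨x, hx, rfl⟩
      exact (congrArg S.mkQ (comp_of_mem_ne hij hx)).trans (map_zero _)
    · intro x
      obtain ⟨x, rfl⟩ := S.mkQ_surjective x
      obtain ⟨s, hs⟩ := M.exists_sum_comp x
      refine ⟨s, ?_⟩
      have h := congrArg S.mkQ (hs s subset_rfl)
      rw [map_sum] at h
      exact h
  smul_mem := by
    rintro i j _ a ⟨x, hx, rfl⟩ ha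
    exact ⟨MulOpposite.op a • x, M.smul_mem hx ha, rfl⟩

/-- The direct sum of two graded modules. -/
noncomputable def prod (M N : GrMod.{w, v, u} 𝒜) : GrMod.{w, v, u} 𝒜 where
  carrier := M.carrier × N.carrier
  deg i := (M.deg i).prod (N.deg i)
  isInternal := by
    refine isInternal_of_projections _ (fun i => (M.comp i).prodMap (N.comp i)) ?_ ?_ ?_ ?_
    · intro i x
      exact ⟨M.comp_mem i x.1, N.comp_mem i x.2⟩
    · intro i x hx
      exact Prod.ext (comp_of_mem hx.1) (comp_of_mem hx.2)
    · intro i j x hij hx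
      exact Prod.ext (comp_of_mem_ne hij hx.1) (comp_of_mem_ne hij hx.2)
    · intro x
      obtain ⟨s, hs⟩ := M.exists_sum_comp x.1
      obtain ⟨t, ht⟩ := N.exists_sum_comp x.2
      refine ⟨s ∪ t, Prod.ext ?_ ?_⟩
      · rw [Prod.fst_sum]
        exact hs _ Finset.subset_union_left
      · rw [Prod.snd_sum]
        exact ht _ Finset.subset_union_right
  smul_mem hm ha := ⟨M.smul_mem hm.1 ha, N.smul_mem hm.2 ha⟩

variable (𝒜) in
/-- The zero graded module. -/
def zero : GrMod.{w, v, u} 𝒜 where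
  carrier := PUnit
  deg _ := ⊥
  isInternal := by
    exact isInternal_of_projections _ (fun _ => 0) (fun _ _ => rfl) (fun _ _ _ => rfl)
      (fun _ _ _ _ _ => rfl) (fun _ => ⟨∅, rfl⟩)
  smul_mem _ _ := Subsingleton.elim _ _

theorem ker_comp (f : M ⟶ N) (i : ℤ) (x : M.carrier) (hx : x ∈ LinearMap.ker f.hom) :
    M.comp i x ∈ LinearMap.ker f.hom := by
  rw [LinearMap.mem_ker] at hx ⊢
  rw [map_comp, hx, map_zero]

theorem range_comp (f : M ⟶ N) (i : ℤ) (x : N.carrier) (hx : x ∈ LinearMap.range f.hom) :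
    N.comp i x ∈ LinearMap.range f.hom := by
  obtain ⟨y, rfl⟩ := hx
  exact ⟨M.comp i y, map_comp f i y⟩

/-- The inclusion of the kernel. -/
noncomputable def kerι (f : M ⟶ N) : M.ofSubmodule (LinearMap.ker f.hom) (ker_comp f) ⟶ M :=
  ⟨(LinearMap.ker f.hom).subtype, fun h => h⟩

/-- The projection to the cokernel. -/
noncomputable def cokerπ (f : M ⟶ N) :
    N ⟶ N.quotient (LinearMap.range f.hom) (range_comp f) :=
  ⟨(LinearMap.range f.hom).mkQ, fun h => ⟨_, h, rfl⟩⟩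

theorem injective_of_mono (f : M ⟶ N) [Mono f] : Function.Injective f.hom := by
  have h : kerι f = 0 := by
    rw [← cancel_mono f]
    exact hom_ext_apply fun x => (LinearMap.mem_ker.1 x.2).trans (map_zero f.hom).symm
  rw [← LinearMap.ker_eq_bot, eq_bot_iff]
  intro x hx
  exact LinearMap.congr_fun (congrArg Hom.hom h) ⟨x, hx⟩

theorem surjective_of_epi (f : M ⟶ N) [Epi f] : Function.Surjective f.hom := by
  have h : cokerπ f = 0 := by
    rw [← cancel_epi f]
    exact hom_ext_apply fun x =>
      (Submodule.Quotient.mk_eq_zero _).2 (LinearMap.mem_range_self f.hom x)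
  rw [← LinearMap.range_eq_top, eq_top_iff]
  intro x _
  exact (Submodule.Quotient.mk_eq_zero _).1 (LinearMap.congr_fun (congrArg Hom.hom h) x)

theorem mono_of_injective {f : M ⟶ N} (hf : Function.Injective f.hom) : Mono f :=
  ⟨fun _ _ hgh => hom_ext_apply fun x => hf (LinearMap.congr_fun (congrArg Hom.hom hgh) x)⟩

theorem epi_of_surjective {f : M ⟶ N} (hf : Function.Surjective f.hom) : Epi f :=
  ⟨fun _ _ hgh => hom_ext_apply fun x => by
    obtain ⟨x, rfl⟩ := hf x
    exact LinearMap.congr_fun (congrArg Hom.hom hgh) x⟩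

theorem mem_of_map_mem {f : M ⟶ N} (hf : Function.Injective f.hom) {i : ℤ} {x : M.carrier}
    (hx : f.hom x ∈ N.deg i) : x ∈ M.deg i := by
  have h : M.comp i x = x := hf (by rw [map_comp, comp_of_mem hx])
  rw [← h]
  exact M.comp_mem i x

theorem comp_eq_zero {f : M ⟶ N} {g : N ⟶ K}
    (h : LinearMap.range f.hom = LinearMap.ker g.hom) : f ≫ g = 0 :=
  hom_ext_apply fun x => by
    have : f.hom x ∈ LinearMap.ker g.hom := h ▸ LinearMap.mem_range_self f.hom x
    exact this

/-- An injective morphism whose image is the kernel of `g` is a categorical kernel of `g`. -/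
noncomputable def isLimitOfExact (f : M ⟶ N) (g : N ⟶ K) (hf : Function.Injective f.hom)
    (h : LinearMap.range f.hom = LinearMap.ker g.hom) :
    IsLimit (KernelFork.ofι f (comp_eq_zero h)) :=
  haveI := mono_of_injective hf
  KernelFork.IsLimit.ofι' f (comp_eq_zero h) fun {T} k hk =>
    have hk' : ∀ x, k.hom x ∈ LinearMap.range f.hom := fun x => by
      rw [h]
      exact LinearMap.congr_fun (congrArg Hom.hom hk) x
    have key : ∀ x, f.hom ((LinearEquiv.ofInjective f.hom hf).symm
        (k.hom.codRestrict (LinearMap.range f.hom) hk' x)) = k.hom x := fun x =>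
      congrArg Subtype.val ((LinearEquiv.ofInjective f.hom hf).apply_symm_apply
        (k.hom.codRestrict (LinearMap.range f.hom) hk' x))
    ⟨⟨(LinearEquiv.ofInjective f.hom hf).symm.toLinearMap ∘ₗ
        k.hom.codRestrict (LinearMap.range f.hom) hk', fun {i m} hm =>
          mem_of_map_mem hf ((key m).symm ▸ k.map_mem hm)⟩,
      hom_ext_apply key⟩

/-- A surjective morphism whose kernel is the image of `f` is a categorical cokernel of `f`. -/
noncomputable def isColimitOfExact (f : M ⟶ N) (g : N ⟶ K) (hg : Function.Surjective g.hom)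
    (h : LinearMap.range f.hom = LinearMap.ker g.hom) :
    IsColimit (CokernelCofork.ofπ g (comp_eq_zero h)) :=
  haveI := epi_of_surjective hg
  CokernelCofork.IsColimit.ofπ' g (comp_eq_zero h) fun {T} k hk =>
    have hk' : LinearMap.ker g.hom ≤ LinearMap.ker k.hom := by
      rw [← h]
      rintro _ ⟨x, rfl⟩
      exact LinearMap.congr_fun (congrArg Hom.hom hk) x
    have key : ∀ x, ((LinearMap.ker g.hom).liftQ k.hom hk')
        ((g.hom.quotKerEquivOfSurjective hg).symm (g.hom x)) = k.hom x := fun x => by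
      have : (g.hom.quotKerEquivOfSurjective hg).symm (g.hom x) =
          (LinearMap.ker g.hom).mkQ x := by
        rw [LinearEquiv.symm_apply_eq]
        rfl
      rw [this]
      rfl
    ⟨⟨(LinearMap.ker g.hom).liftQ k.hom hk' ∘ₗ
        (g.hom.quotKerEquivOfSurjective hg).symm.toLinearMap, fun {i y} hy => by
          obtain ⟨x, rfl⟩ := hg y
          have hx : g.hom x = g.hom (N.comp i x) := by rw [map_comp, comp_of_mem hy]
          rw [LinearMap.comp_apply, hx]
          erw [key]
          exact k.map_mem (N.comp_mem i x)⟩,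
      hom_ext_apply key⟩

theorem kerι_exact (f : M ⟶ N) : LinearMap.range (kerι f).hom = LinearMap.ker f.hom :=
  Submodule.range_subtype _

theorem cokerπ_exact (f : M ⟶ N) : LinearMap.range f.hom = LinearMap.ker (cokerπ f).hom :=
  (Submodule.ker_mkQ _).symm

theorem kerι_injective (f : M ⟶ N) : Function.Injective (kerι f).hom :=
  Subtype.val_injective

theorem cokerπ_surjective (f : M ⟶ N) : Function.Surjective (cokerπ f).hom :=
  Submodule.mkQ_surjective _

instance : HasKernels (GrMod.{w, v, u} 𝒜) :=
  ⟨fun f => HasLimit.mk ⟨_, isLimitOfExact (kerι f) f (kerι_injective f) (kerι_exact f)⟩⟩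

instance : HasCokernels (GrMod.{w, v, u} 𝒜) :=
  ⟨fun f => HasColimit.mk
    ⟨_, isColimitOfExact f (cokerπ f) (cokerπ_surjective f) (cokerπ_exact f)⟩⟩

instance : HasZeroObject (GrMod.{w, v, u} 𝒜) :=
  ⟨zero 𝒜, (IsZero.iff_id_eq_zero _).2 (hom_ext_apply fun _ => rfl)⟩

instance : HasBinaryBiproducts (GrMod.{w, v, u} 𝒜) :=
  ⟨fun M N => hasBinaryBiproduct_of_total
    { pt := prod M N
      fst := ⟨LinearMap.fst _ _ _, fun h => h.1⟩
      snd := ⟨LinearMap.snd _ _ _, fun h => h.2⟩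
      inl := ⟨LinearMap.inl _ _ _, fun h => ⟨h, zero_mem _⟩⟩
      inr := ⟨LinearMap.inr _ _ _, fun h => ⟨zero_mem _, h⟩⟩ }
    (hom_ext_apply fun x => Prod.ext (add_zero x.1) (zero_add x.2))⟩

instance : HasFiniteProducts (GrMod.{w, v, u} 𝒜) :=
  hasFiniteProducts_of_has_binary_and_terminal

/-- The category `GrMod A` of graded modules is abelian. -/
noncomputable instance : Abelian (GrMod.{w, v, u} 𝒜) where
  normalMonoOfMono f _ :=
    ⟨{ Z := _
       g := cokerπ f
       w := comp_eq_zero (cokerπ_exact f)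
       isLimit := isLimitOfExact f (cokerπ f) (injective_of_mono f) (cokerπ_exact f) }⟩
  normalEpiOfEpi f _ :=
    ⟨{ W := _
       g := kerι f
       w := comp_eq_zero (kerι_exact f)
       isColimit := isColimitOfExact (kerι f) f (surjective_of_epi f) (kerι_exact f) }⟩

/-! ### The regular module -/

/-- The grading of `A`, extended by zero to negative degrees. -/
def selfDeg (𝒜 : ℕ → Submodule 𝕜 A) : ℤ → AddSubgroup A
  | Int.ofNat n => (𝒜 n).toAddSubgroup
  | Int.negSucc _ => ⊥

/-- The projections of `A` to the components of `selfDeg`. -/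
def selfComp (𝒜 : ℕ → Submodule 𝕜 A) [GradedAlgebra 𝒜] : ℤ → A →+ A
  | Int.ofNat n => GradedRing.proj 𝒜 n
  | Int.negSucc _ => 0

/-- The graded right module `A_A`. -/
def self (𝒜 : ℕ → Submodule 𝕜 A) [GradedAlgebra 𝒜] : GrMod.{w, u, u} 𝒜 where
  carrier := A
  deg := selfDeg 𝒜
  isInternal := by
    refine isInternal_of_projections _ (selfComp 𝒜) ?_ ?_ ?_ ?_
    · rintro (n | n) x
      · exact (DirectSum.decompose 𝒜 x n).2
      · exact rfl
    · rintro (n | n) x hx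
      · exact DirectSum.decompose_of_mem_same 𝒜 hx
      · exact (hx : x = 0).symm
    · rintro (n | n) (k | k) x hij hx
      · exact DirectSum.decompose_of_mem_ne 𝒜 hx fun h => hij (congrArg Int.ofNat h)
      · rfl
      · rw [show x = 0 from hx, map_zero]
      · rfl
    · intro x
      classical
      refine ⟨(DirectSum.decompose 𝒜 x).support.map Nat.castEmbedding, ?_⟩
      rw [Finset.sum_map]
      exact DirectSum.sum_support_decompose 𝒜 x
  smul_mem := by
    rintro (i | i) j m a hm ha
    · exact SetLike.mul_mem_graded (A := 𝒜) hm ha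
    · rw [show m = 0 from hm, smul_zero]
      exact zero_mem _

end GrMod

namespace GrMod

variable {𝕜 : Type w} [CommRing 𝕜] {A : Type u} [Ring A] [Algebra 𝕜 A]
  {𝒜 : ℕ → Submodule 𝕜 A}

/-! The two dimensions are compared by dimension shifting, which needs two facts about finitely
graded modules.

Injectivity is the same in both categories (`injective_forgetGrading_iff`). If `M` is injective as
an ungraded module, a graded extension problem into `M` has an ungraded solution `h`. Its degree
zero part, `x ↦ h(x)_i` on elements of degree `i`, is again `A`-linear, and it still solves the
problem because the given maps preserve degrees. Conversely, a graded injective `M` that embeds by a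
graded map into some `E` is a graded direct summand of `E`, so it is injective as a module as soon
as `E` is.

There are enough such `E` (`exists_injective_hom`). If all degrees of `M` lie in the finite set `S`
and `M` embeds as a group into a divisible group `D`, then `M` embeds into `Hom_ℤ(A, D^S)` by `m ↦
(a ↦ (φ((ma)_i))_i)`. This coinduced module is injective, and because `A` and `S` are bounded it
carries a finite grading. The cokernel of `M → E` is again finitely graded, so the same `E` serves
for the shift in both categories. -/

theorem comp_eq_zero_of_deg_eq_bot (M : GrMod.{w, v, u} 𝒜) {i : ℤ} (hi : M.deg i = ⊥)
    (x : M.carrier) : M.comp i x = 0 := by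
  have h := M.comp_mem i x
  rwa [hi, AddSubgroup.mem_bot] at h

/-- Taking components commutes with the action of homogeneous elements, up to a shift. -/
theorem comp_smul (M : GrMod.{w, v, u} 𝒜) {j : ℕ} {a : A} (ha : a ∈ 𝒜 j) (i : ℤ)
    (x : M.carrier) : M.comp (i + j) (MulOpposite.op a • x) = MulOpposite.op a • M.comp i x := by
  obtain ⟨s, hs⟩ := M.exists_sum_comp x
  conv_lhs => rw [← hs _ (Finset.subset_insert i s), Finset.smul_sum, map_sum]
  rw [Finset.sum_eq_single i]
  · exact comp_of_mem (M.smul_mem (M.comp_mem i x) ha)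
  · intro k _ hk
    exact comp_of_mem_ne (by simpa using hk) (M.smul_mem (M.comp_mem k x) ha)
  · intro h
    exact absurd (Finset.mem_insert_self i s) h

theorem IsFinitelyGraded.sum_comp {M : GrMod.{w, v, u} 𝒜} {n : ℕ}
    (hM : ∀ i : ℤ, (n : ℤ) < |i| → M.deg i = ⊥) (x : M.carrier) :
    ∑ i ∈ Finset.Icc (-n : ℤ) n, M.comp i x = x := by
  obtain ⟨s, hs⟩ := M.exists_sum_comp x
  refine (Finset.sum_subset Finset.subset_union_right fun i _ hi => ?_).trans
    (hs _ Finset.subset_union_left)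
  refine M.comp_eq_zero_of_deg_eq_bot (hM i ?_) x
  by_contra h
  exact hi (Finset.mem_Icc.2 (abs_le.1 (not_lt.1 h)))

/-- Two additive maps that agree on homogeneous elements are equal. -/
theorem addMonoidHom_ext (M : GrMod.{w, v, u} 𝒜) {G : Type*} [AddCommGroup G]
    {f g : M.carrier →+ G} (h : ∀ i, ∀ x ∈ M.deg i, f x = g x) : f = g := by
  ext x
  obtain ⟨s, hs⟩ := M.exists_sum_comp x
  rw [← hs s subset_rfl, map_sum, map_sum]
  exact Finset.sum_congr rfl fun i _ => h i _ (M.comp_mem i x)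

/-! ### The degree zero part of a linear map -/

/-- The degree zero part of a linear map to a finitely graded module, as an additive map. -/
noncomputable def degreeZeroAux {M N : GrMod.{w, v, u} 𝒜} (n : ℕ)
    (h : M.carrier →ₗ[Aᵐᵒᵖ] N.carrier) : M.carrier →+ N.carrier :=
  ∑ i ∈ Finset.Icc (-n : ℤ) n, ((N.comp i).comp h.toAddMonoidHom).comp (M.comp i)

theorem degreeZeroAux_of_mem {M N : GrMod.{w, v, u} 𝒜} {n : ℕ}
    (hN : ∀ i : ℤ, (n : ℤ) < |i| → N.deg i = ⊥) (h : M.carrier →ₗ[Aᵐᵒᵖ] N.carrier)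
    {i : ℤ} {x : M.carrier} (hx : x ∈ M.deg i) :
    degreeZeroAux n h x = N.comp i (h x) := by
  rw [degreeZeroAux, AddMonoidHom.finsetSum_apply, Finset.sum_eq_single i]
  · simp [comp_of_mem hx]
  · intro k _ hk
    simp [comp_of_mem_ne hk.symm hx]
  -- Outside the interval `N` has no component, so the absent summand would vanish anyway.
  · intro hi
    refine N.comp_eq_zero_of_deg_eq_bot (hN i ?_) _
    by_contra h
    exact hi (Finset.mem_Icc.2 (abs_le.1 (not_lt.1 h)))

/-- The degree zero part of a linear map to a finitely graded module. -/
noncomputable def degreeZero [GradedAlgebra 𝒜] {M N : GrMod.{w, v, u} 𝒜} {n : ℕ}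
    (hN : ∀ i : ℤ, (n : ℤ) < |i| → N.deg i = ⊥) (h : M.carrier →ₗ[Aᵐᵒᵖ] N.carrier) :
    M ⟶ N where
  hom :=
    { degreeZeroAux n h with
      map_smul' := by
        intro a x
        change degreeZeroAux n h (a • x) = a • degreeZeroAux n h x
        obtain ⟨a, rfl⟩ := MulOpposite.op_surjective a
        induction a using DirectSum.Decomposition.inductionOn 𝒜 with
        | zero => simp
        | add a b ha hb => simp only [MulOpposite.op_add, add_smul, map_add, ha, hb]
        | @homogeneous j a =>
          -- For `a` of degree `j` both sides are additive in `x`, so `x` may be taken of degree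
          -- `i`. The claim then reads `(h(x)a)_{i+j} = h(x)_i a`.
          have := M.addMonoidHom_ext
            (f := (degreeZeroAux n h).comp (DistribSMul.toAddMonoidHom _ (MulOpposite.op (a : A))))
            (g := (DistribSMul.toAddMonoidHom _ (MulOpposite.op (a : A))).comp
              (degreeZeroAux n h)) fun i y hy => by
            simp only [AddMonoidHom.comp_apply, DistribSMul.toAddMonoidHom_apply]
            rw [degreeZeroAux_of_mem hN h hy, degreeZeroAux_of_mem hN h (M.smul_mem hy a.2),
              map_smul, comp_smul N a.2]
          exact DFunLike.congr_fun this x }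
  map_mem := by
    intro i m hm
    change degreeZeroAux n h m ∈ _
    rw [degreeZeroAux_of_mem hN h hm]
    exact N.comp_mem _ _

theorem degreeZero_apply_of_mem [GradedAlgebra 𝒜] {M N : GrMod.{w, v, u} 𝒜} {n : ℕ}
    (hN : ∀ i : ℤ, (n : ℤ) < |i| → N.deg i = ⊥) (h : M.carrier →ₗ[Aᵐᵒᵖ] N.carrier)
    {i : ℤ} {x : M.carrier} (hx : x ∈ M.deg i) :
    (degreeZero hN h).hom x = N.comp i (h x) :=
  degreeZeroAux_of_mem hN h hx

/-- A finitely graded module that is injective as a module is injective as a graded module. -/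
theorem injective_of_injective_forgetGrading [GradedAlgebra 𝒜] {M : GrMod.{w, v, u} 𝒜}
    (hM : M.IsFinitelyGraded) (hI : Injective ((forgetGrading 𝒜).obj M)) : Injective M where
  factors {X Y} g f _ := by
    obtain ⟨n, hn⟩ := hM
    have : Mono ((forgetGrading 𝒜).map f) :=
      (ModuleCat.mono_iff_injective _).2 (injective_of_mono f)
    obtain ⟨h, hh⟩ : ∃ h : Y.carrier →ₗ[Aᵐᵒᵖ] M.carrier, ∀ x, h (f.hom x) = g.hom x :=
      ⟨(Injective.factorThru ((forgetGrading 𝒜).map g) ((forgetGrading 𝒜).map f)).hom,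
        ConcreteCategory.congr_hom
          (Injective.comp_factorThru ((forgetGrading 𝒜).map g) ((forgetGrading 𝒜).map f))⟩
    -- On the image of a homogeneous `y`, the value `h(f y) = g y` already lies in the right degree,
    -- so passing to the degree zero part changes nothing.
    refine ⟨degreeZero hn h, hom_ext_apply fun x => ?_⟩
    refine DFunLike.congr_fun (X.addMonoidHom_ext
      (f := (f ≫ degreeZero hn h).hom.toAddMonoidHom) (g := g.hom.toAddMonoidHom) ?_) x
    intro i y hy
    change (degreeZero hn h).hom (f.hom y) = g.hom y
    rw [degreeZero_apply_of_mem hn _ (f.map_mem hy), hh]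
    exact comp_of_mem (g.map_mem hy)

/-! ### Coinduced modules -/

/-- The coinduced right `A`-module `Hom_ℤ(A, D)`. -/
def Coind (A : Type u) [Ring A] (D : Type v) [AddCommGroup D] : Type max u v := A →+ D

namespace Coind

variable {D : Type v} [AddCommGroup D]

instance : AddCommGroup (Coind A D) := inferInstanceAs (AddCommGroup (A →+ D))

instance : FunLike (Coind A D) A D := inferInstanceAs (FunLike (A →+ D) A D)

instance : AddMonoidHomClass (Coind A D) A D :=
  inferInstanceAs (AddMonoidHomClass (A →+ D) A D)

@[ext]
theorem ext {f g : Coind A D} (h : ∀ a, f a = g a) : f = g := DFunLike.ext f g h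

@[simp] theorem add_apply (f g : Coind A D) (a : A) : (f + g) a = f a + g a := rfl
@[simp] theorem zero_apply (a : A) : (0 : Coind A D) a = 0 := rfl
@[simp] theorem neg_apply (f : Coind A D) (a : A) : (-f) a = -f a := rfl

theorem sum_apply {ι : Type*} (s : Finset ι) (f : ι → Coind A D) (a : A) :
    (∑ i ∈ s, f i) a = ∑ i ∈ s, f i a :=
  AddMonoidHom.finsetSum_apply (M := A) (N := D) f s a

instance : Module Aᵐᵒᵖ (Coind A D) where
  smul b f := (show A →+ D from f).comp (AddMonoidHom.mulLeft b.unop)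
  one_smul f := ext fun a => congrArg f (one_mul a)
  mul_smul b c f := ext fun a => congrArg f (mul_assoc c.unop b.unop a)
  smul_zero _ := rfl
  smul_add _ _ _ := rfl
  add_smul b c f := ext fun a =>
    (congrArg f (add_mul b.unop c.unop a)).trans (map_add f _ _)
  zero_smul f := ext fun a => (congrArg f (zero_mul a)).trans (map_zero f)

@[simp] theorem smul_apply (b : Aᵐᵒᵖ) (f : Coind A D) (a : A) : (b • f) a = f (b.unop * a) := rfl

/-- The linear map to the coinduced module given by an additive map. -/
def lift {M : Type*} [AddCommGroup M] [Module Aᵐᵒᵖ M] (φ : M →+ D) : M →ₗ[Aᵐᵒᵖ] Coind A D where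
  toFun m := (show A →+ D from
    { toFun := fun a => φ (MulOpposite.op a • m)
      map_zero' := by simp
      map_add' := fun a b => by simp [add_smul] })
  map_add' m m' := ext fun a => (congrArg φ (smul_add _ m m')).trans (map_add φ _ _)
  map_smul' b m := ext fun a => congrArg φ (smul_smul (MulOpposite.op a) b m)

@[simp] theorem lift_apply {M : Type*} [AddCommGroup M] [Module Aᵐᵒᵖ M] (φ : M →+ D) (m : M)
    (a : A) : lift (A := A) φ m a = φ (MulOpposite.op a • m) := rfl

/-- The module coinduced from a divisible group is injective. -/
theorem injective {D : Type u} [AddCommGroup D] [DivisibleBy D ℤ] :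
    Injective (ModuleCat.of Aᵐᵒᵖ (Coind A D)) where
  factors {X Y} g f _ := by
    -- Evaluation at `1` identifies linear maps `X → Hom_ℤ(A, D)` with additive maps `X → D`. The
    -- latter extend along injections since `D` is divisible, and `lift` is the inverse of this
    -- identification.
    obtain ⟨h, hh⟩ := (Module.Baer.of_divisible D).extension_property_addMonoidHom
      f.hom.toAddMonoidHom ((ModuleCat.mono_iff_injective f).1 inferInstance)
      { toFun := fun x => g.hom x (1 : A)
        map_zero' := by simp
        map_add' := fun x y => by simp }
    refine ⟨ModuleCat.ofHom (lift h), ModuleCat.hom_ext (LinearMap.ext fun x => ext fun a => ?_)⟩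
    have key := DFunLike.congr_fun hh (MulOpposite.op a • x)
    simp only [AddMonoidHom.comp_apply] at key
    simpa using key

end Coind

/-! ### Gradings on coinduced modules -/

section GradedCoind

variable (𝒜) in
/-- The homogeneous components of `Hom_ℤ(A, D^S)`, where the factor of `D^S` that belongs to
`i ∈ S` has degree `i`. -/
def coindDeg (S : Finset ℤ) (D : Type v) [AddCommGroup D] (k : ℤ) :
    AddSubgroup (Coind A (S → D)) where
  carrier := {f | ∀ (j : ℕ), ∀ a ∈ 𝒜 j, ∀ i : S, (i : ℤ) ≠ k + j → f a i = 0}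
  zero_mem' _ _ _ _ _ := rfl
  add_mem' hf hg j a ha i hi := by simp [hf j a ha i hi, hg j a ha i hi]
  neg_mem' hf j a ha i hi := by simp [hf j a ha i hi]

variable [GradedAlgebra 𝒜]

theorem selfComp_of_mem_same {j : ℕ} {a : A} (ha : a ∈ 𝒜 j) : selfComp 𝒜 j a = a :=
  DirectSum.decompose_of_mem_same 𝒜 ha

theorem selfComp_of_mem_ne {j : ℕ} {a : A} (ha : a ∈ 𝒜 j) {i : ℤ} (hi : i ≠ j) :
    selfComp 𝒜 i a = 0 := by
  rcases i with i | i
  · exact DirectSum.decompose_of_mem_ne 𝒜 ha fun h => hi (congrArg Int.ofNat h.symm)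
  · rfl

/-- Two elements of a coinduced module that agree on homogeneous elements are equal. -/
theorem Coind.ext_of_homogeneous {D : Type v} [AddCommGroup D] {f g : Coind A D}
    (h : ∀ (j : ℕ), ∀ a ∈ 𝒜 j, f a = g a) : f = g := by
  ext a
  induction a using DirectSum.Decomposition.inductionOn 𝒜 with
  | zero => simp
  | add a b ha hb => simp only [map_add, ha, hb]
  | @homogeneous j a => exact h j a a.2

variable (𝒜) in
/-- The projections to the homogeneous components of `Hom_ℤ(A, D^S)`. -/
def coindComp (S : Finset ℤ) (D : Type v) [AddCommGroup D] (k : ℤ) :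
    Coind A (S → D) →+ Coind A (S → D) where
  toFun f := (show A →+ (S → D) from
    -- A map of degree `k` sends `A_j` to the factor with index `k + j`, so the factor `i` sees only
    -- the component of `a` in degree `i - k`. That component is `0` when `i - k` is negative.
    { toFun := fun a i => f (selfComp 𝒜 (i - k) a) i
      map_zero' := by ext; simp
      map_add' := fun a b => by ext; simp })
  map_zero' := rfl
  map_add' _ _ := rfl

theorem coindComp_apply {S : Finset ℤ} {D : Type v} [AddCommGroup D] (k : ℤ)
    (f : Coind A (S → D)) (a : A) (i : S) :
    coindComp 𝒜 S D k f a i = f (selfComp 𝒜 (i - k) a) i := rfl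

/-- The graded coinduced module `Hom_ℤ(A, D^S)`. -/
def coind (hA : IsFinitelyGradedAlgebra 𝒜) (S : Finset ℤ) (D : Type u) [AddCommGroup D] :
    GrMod.{w, u, u} 𝒜 where
  carrier := Coind A (S → D)
  deg := coindDeg 𝒜 S D
  isInternal := by
    refine isInternal_of_projections _ (coindComp 𝒜 S D) ?_ ?_ ?_ ?_
    · intro k f j a ha i hi
      rw [coindComp_apply, selfComp_of_mem_ne ha (by omega), map_zero]
      rfl
    · intro k f hf
      refine Coind.ext_of_homogeneous (𝒜 := 𝒜) fun j a ha => funext fun i => ?_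
      rw [coindComp_apply]
      by_cases hi : (i : ℤ) = k + j
      · rw [show (i : ℤ) - k = j by omega, selfComp_of_mem_same ha]
      · rw [selfComp_of_mem_ne ha (by omega), map_zero, hf j a ha i hi]
        rfl
    · intro k k' f hk hf
      refine Coind.ext_of_homogeneous (𝒜 := 𝒜) fun j a ha => funext fun i => ?_
      rw [coindComp_apply]
      by_cases hi : (i : ℤ) = k' + j
      · rw [show (i : ℤ) - k' = j by omega, selfComp_of_mem_same ha, hf j a ha i (by omega)]
        rfl
      · rw [selfComp_of_mem_ne ha (by omega), map_zero]
        rfl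
    · intro f
      obtain ⟨l, hl⟩ := hA
      -- A nonzero component of degree `k` needs `k = i - j` with `i ∈ S` and `A_j ≠ 0`, hence `j ≤
      -- l`. These are finitely many degrees because `A` is finitely graded.
      refine ⟨S.biUnion fun i => (Finset.range (l + 1)).image fun j : ℕ => i - (j : ℤ),
        Coind.ext_of_homogeneous (𝒜 := 𝒜) fun j a ha => funext fun i => ?_⟩
      rw [Coind.sum_apply, Finset.sum_apply]
      simp only [coindComp_apply]
      by_cases hj : l < j
      · obtain rfl : a = 0 := by
          rw [hl j hj] at ha
          exact ha
        simp
      rw [Finset.sum_eq_single ((i : ℤ) - j)]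
      · rw [sub_sub_cancel, selfComp_of_mem_same ha]
      · intro k _ hk
        rw [selfComp_of_mem_ne ha (by omega), map_zero]
        rfl
      · intro h
        refine h.elim (Finset.mem_biUnion.2 ⟨i, i.2, Finset.mem_image.2 ⟨j, ?_, rfl⟩⟩)
        exact Finset.mem_range.2 (by omega)
  smul_mem := by
    intro k j f b hf hb j' a ha i hi
    refine hf (j + j') (b * a) (SetLike.mul_mem_graded hb ha) i ?_
    push_cast
    omega

/-- The only possible degrees are `i - j` with `|i| ≤ n` and `0 ≤ j ≤ l`, where `l` bounds the
degrees of `A`. They are at most `n + l` in absolute value. -/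
theorem coind_isFinitelyGraded (hA : IsFinitelyGradedAlgebra 𝒜) (n : ℕ) (D : Type u)
    [AddCommGroup D] : (coind hA (Finset.Icc (-n : ℤ) n) D).IsFinitelyGraded := by
  obtain ⟨l, hl⟩ := id hA
  refine ⟨n + l, fun k hk => (AddSubgroup.eq_bot_iff_forall _).2
    fun (f : Coind A (Finset.Icc (-n : ℤ) n → D)) hf => ?_⟩
  refine Coind.ext_of_homogeneous (𝒜 := 𝒜) fun j a ha => funext fun i => ?_
  by_cases hj : l < j
  · obtain rfl : a = 0 := by
      rw [hl j hj] at ha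
      exact ha
    rw [map_zero]
    rfl
  · refine hf j a ha i fun hi => ?_
    have := Finset.mem_Icc.1 i.2
    rw [lt_abs] at hk
    push_cast at hk
    omega

theorem injective_forgetGrading_coind (hA : IsFinitelyGradedAlgebra 𝒜) (S : Finset ℤ) (D : Type u)
    [AddCommGroup D] [DivisibleBy D ℤ] : Injective ((forgetGrading 𝒜).obj (coind hA S D)) :=
  Coind.injective (A := A) (D := S → D)

/-- The morphism to a graded coinduced module that is given by an additive map. -/
noncomputable def toCoind (M : GrMod.{w, u, u} 𝒜) (hA : IsFinitelyGradedAlgebra 𝒜) (S : Finset ℤ)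
    {D : Type u} [AddCommGroup D] (φ : M.carrier →+ D) : M ⟶ coind hA S D where
  hom := Coind.lift (AddMonoidHom.pi fun i : S => φ.comp (M.comp i))
  map_mem := by
    intro k m hm j a ha i hi
    change φ (M.comp i (MulOpposite.op a • m)) = 0
    rw [comp_of_mem_ne hi.symm (M.smul_mem hm ha), map_zero]

/-- Evaluating the image of `x` at `1 ∈ A` returns all `φ(x_i)` with `|i| ≤ n`. These determine `x`,
which has no other components. -/
theorem toCoind_injective {M : GrMod.{w, u, u} 𝒜} (hA : IsFinitelyGradedAlgebra 𝒜) {n : ℕ}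
    (hM : ∀ i : ℤ, (n : ℤ) < |i| → M.deg i = ⊥) {D : Type u} [AddCommGroup D]
    {φ : M.carrier →+ D} (hφ : Function.Injective φ) :
    Function.Injective (M.toCoind hA (Finset.Icc (-n : ℤ) n) φ).hom := by
  rw [← LinearMap.ker_eq_bot, eq_bot_iff]
  intro x hx
  rw [Submodule.mem_bot, ← IsFinitelyGraded.sum_comp hM x]
  refine Finset.sum_eq_zero fun i hi => hφ ?_
  have h₀ : Coind.lift (A := A)
      (AddMonoidHom.pi fun i : Finset.Icc (-n : ℤ) n => φ.comp (M.comp i)) x = 0 := hx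
  have h : φ (M.comp i (MulOpposite.op (1 : A) • x)) = 0 :=
    congrFun (DFunLike.congr_fun h₀ (1 : A)) ⟨i, hi⟩
  rwa [MulOpposite.op_one, one_smul, ← map_zero φ] at h

/-- A finitely graded module embeds into a finitely graded module that is injective as an ungraded
module. -/
theorem exists_injective_hom {M : GrMod.{w, u, u} 𝒜} (hA : IsFinitelyGradedAlgebra 𝒜)
    (hM : M.IsFinitelyGraded) :
    ∃ (E : GrMod.{w, u, u} 𝒜) (f : M ⟶ E), E.IsFinitelyGraded ∧
      Injective ((forgetGrading 𝒜).obj E) ∧ Function.Injective f.hom := by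
  obtain ⟨n, hn⟩ := hM
  -- Characters with values in `ℚ/ℤ` separate points, so the product of all of them embeds `M` into
  -- a divisible group.
  let φ : M.carrier →+ (CharacterModule M.carrier → AddCircle (1 : ℚ)) :=
    AddMonoidHom.pi fun c => c
  have hφ : Function.Injective φ := (injective_iff_map_eq_zero φ).2 fun x hx =>
    CharacterModule.eq_zero_of_character_apply fun c => congrFun hx c
  exact ⟨_, M.toCoind hA (Finset.Icc (-n : ℤ) n) φ, coind_isFinitelyGraded hA n _,
    injective_forgetGrading_coind hA _ _, toCoind_injective hA hn hφ⟩

end GradedCoind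

/-! ### Comparison of injective dimensions -/

theorem IsFinitelyGraded.quotient {M : GrMod.{w, v, u} 𝒜} (hM : M.IsFinitelyGraded)
    (S : Submodule Aᵐᵒᵖ M.carrier) (hS : ∀ i x, x ∈ S → M.comp i x ∈ S) :
    (M.quotient S hS).IsFinitelyGraded := by
  obtain ⟨n, hn⟩ := hM
  refine ⟨n, fun i hi => ?_⟩
  change (M.deg i).map _ = ⊥
  rw [hn i hi, AddSubgroup.map_bot]

theorem isFinitelyGraded_self [GradedAlgebra 𝒜] (hA : IsFinitelyGradedAlgebra 𝒜) :
    (GrMod.self 𝒜).IsFinitelyGraded := by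
  obtain ⟨l, hl⟩ := hA
  refine ⟨l, ?_⟩
  rintro (i | i) hi
  · change (𝒜 i).toAddSubgroup = ⊥
    rw [hl i (by simpa using hi)]
    rfl
  · rfl

/-- From graded to ungraded: the embedding into `E` splits in the graded category, functors preserve
retracts, and retracts of injectives are injective. -/
theorem injective_forgetGrading_iff [GradedAlgebra 𝒜] {M : GrMod.{w, u, u} 𝒜}
    (hA : IsFinitelyGradedAlgebra 𝒜) (hM : M.IsFinitelyGraded) :
    Injective ((forgetGrading 𝒜).obj M) ↔ Injective M := by
  refine ⟨injective_of_injective_forgetGrading hM, fun hI => ?_⟩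
  obtain ⟨E, f, -, hE, hf⟩ := exists_injective_hom hA hM
  have := mono_of_injective hf
  exact (((⟨f, Injective.factorThru (𝟙 M) f, Injective.comp_factorThru _ _⟩ :
    Retract M E)).map (forgetGrading 𝒜)).injective

theorem isZero_iff_subsingleton {M : GrMod.{w, v, u} 𝒜} :
    IsZero M ↔ Subsingleton M.carrier := by
  rw [IsZero.iff_id_eq_zero]
  refine ⟨fun h => ⟨fun x y => ?_⟩, fun h => hom_ext_apply fun _ => Subsingleton.elim _ _⟩
  have h0 : ∀ x : M.carrier, x = 0 := fun x => LinearMap.congr_fun (congrArg Hom.hom h) x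
  rw [h0 x, h0 y]

/-- The sequence of a monomorphism and its cokernel. -/
noncomputable def cokerSequence {M N : GrMod.{w, v, u} 𝒜} (f : M ⟶ N) :
    ShortComplex (GrMod.{w, v, u} 𝒜) :=
  ShortComplex.mk f (cokerπ f) (comp_eq_zero (cokerπ_exact f))

theorem cokerSequence_shortExact {M N : GrMod.{w, v, u} 𝒜} {f : M ⟶ N}
    (hf : Function.Injective f.hom) : (cokerSequence f).ShortExact where
  exact := ShortComplex.exact_of_g_is_cokernel _
    (isColimitOfExact f (cokerπ f) (cokerπ_surjective f) (cokerπ_exact f))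
  mono_f := mono_of_injective hf
  epi_g := epi_of_surjective (cokerπ_surjective f)

/-- The sequence of modules underlying the sequence of a monomorphism and its cokernel. -/
noncomputable def forgetCokerSequence {M N : GrMod.{w, v, u} 𝒜} (f : M ⟶ N) :
    ShortComplex (ModuleCat.{v} Aᵐᵒᵖ) :=
  ShortComplex.mk ((forgetGrading 𝒜).map f) ((forgetGrading 𝒜).map (cokerπ f)) (by
    rw [← Functor.map_comp, comp_eq_zero (cokerπ_exact f)]
    rfl)

theorem forgetCokerSequence_shortExact {M N : GrMod.{w, v, u} 𝒜} {f : M ⟶ N}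
    (hf : Function.Injective f.hom) : (forgetCokerSequence f).ShortExact where
  exact := (ShortComplex.moduleCat_exact_iff_range_eq_ker _).2 (cokerπ_exact f)
  mono_f := (ModuleCat.mono_iff_injective _).2 hf
  epi_g := (ModuleCat.epi_iff_surjective _).2 (cokerπ_surjective f)

/-- Induction by dimension shifting along `0 → M → E → E/M → 0`, where `E` is injective in both
categories and `E/M` is again finitely graded. -/
theorem hasInjectiveDimensionLT_forgetGrading_iff [GradedAlgebra 𝒜]
    (hA : IsFinitelyGradedAlgebra 𝒜) (n : ℕ) {M : GrMod.{w, u, u} 𝒜} (hM : M.IsFinitelyGraded) :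
    HasInjectiveDimensionLT ((forgetGrading 𝒜).obj M) n ↔ HasInjectiveDimensionLT M n := by
  induction n generalizing M with
  | zero =>
    rw [hasInjectiveDimensionLT_zero_iff_isZero, hasInjectiveDimensionLT_zero_iff_isZero,
      isZero_iff_subsingleton]
    exact ModuleCat.isZero_iff_subsingleton
  | succ n ih =>
    -- The shift relates the bound `n + 1` for the cokernel to the bound `n + 2` for `M`. The bound
    -- `1`, which is injectivity, is therefore a separate base case.
    rcases n with _ | n
    · rw [zero_add, ← injective_iff_hasInjectiveDimensionLT_one,
        ← injective_iff_hasInjectiveDimensionLT_one]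
      exact injective_forgetGrading_iff hA hM
    · obtain ⟨E, f, hE, hI, hf⟩ := exists_injective_hom hA hM
      exact ((forgetCokerSequence_shortExact hf).hasInjectiveDimensionLT_X₃_iff n hI).symm.trans
        ((ih (hE.quotient _ _)).trans
          ((cokerSequence_shortExact hf).hasInjectiveDimensionLT_X₃_iff n
            (injective_of_injective_forgetGrading hE hI)))

/-- The dimension is determined by the bounds `HasInjectiveDimensionLT _ n` for all `n`. The bound
`n = 0` detects the zero module and with it the value `-∞`. -/
theorem injectiveDimension_forgetGrading [GradedAlgebra 𝒜] (hA : IsFinitelyGradedAlgebra 𝒜)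
    {M : GrMod.{w, u, u} 𝒜} (hM : M.IsFinitelyGraded) :
    injectiveDimension ((forgetGrading 𝒜).obj M) = injectiveDimension M := by
  simp only [injectiveDimension, hasInjectiveDimensionLT_forgetGrading_iff hA _ hM]

end GrMod

theorem mainTheorem12 {𝕜 : Type w} [CommRing 𝕜] {A : Type u} [Ring A] [Algebra 𝕜 A]
    (𝒜 : ℕ → Submodule 𝕜 A) [GradedAlgebra 𝒜] (hA : IsFinitelyGradedAlgebra 𝒜) :
    (∀ M : GrMod.{w, u, u} 𝒜, M.IsFinitelyGraded →
      injectiveDimension ((GrMod.forgetGrading 𝒜).obj M) = injectiveDimension M) ∧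
    injectiveDimension (ModuleCat.of Aᵐᵒᵖ A) = injectiveDimension (GrMod.self 𝒜) :=
  ⟨fun _ hM => GrMod.injectiveDimension_forgetGrading hA hM,
    -- Forgetting the grading of `GrMod.self 𝒜` gives `ModuleCat.of Aᵐᵒᵖ A` by definition.
    GrMod.injectiveDimension_forgetGrading hA (GrMod.isFinitelyGraded_self hA)⟩
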